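/- Let $d,d'\ge 1$ and fix orthonormal bases of $\mathbb C^{d}$ and $\mathbb C^{d'}$; write $\{|\ell\rangle\}_{\ell=1}^{d}$ for that of $\mathbb C^d$. A state (density matrix) is a positive semidefinite matrix of trace one, and a state is incoherent if it is diagonal in the fixed basis. A maximally incoherent operation (MIO) is a completely positive trace-preserving linear map from $d\times d$ to $d'\times d'$ complex matrices that maps every incoherent state to an incoherent state. For a bipartite positive semidefinite matrix $\Omega$ on $\mathbb C^{d'}\otimes\mathbb C^{d}$ ($A$ is the first factor, $B$ the second), the conditional min-entropy is $$H_{\min}(A|B)_\Omega=-\log_2\min\{\operatorname{Tr}[\tau] : \tau\ge 0,\ I_{d'}\otimes\tau\ge\Omega\}.$$ Let $\rho$ be a $d\times d$ density matrix and $\rho'$ a $d'\times d'$ density matrix. For $d'\times d'$ density matrices $\omega_1,\dots,\omega_d$, each with all diagonal entries equal to $1/d'$, and a $d'\times d'$ density matrix $\eta$, put $$\Omega=\frac{1}{d+1}\Big(\sum_{\ell=1}^{d}\omega_\ell\otimes|\ell\rangle\langle\ell|+\eta\otimes\rho^{T}\Big),\qquad W_{\boldsymbol\omega,\eta}(\rho,\rho')=2^{-H_{\min}(A|B)_\Omega}-\frac{\frac{d}{d'}+\operatorname{Tr}[\eta\rho']}{d+1}.$$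 Then there is a maximally incoherent operation $\mathcal E$ with $\mathcal E(\rho)=\rho'$ if and only if $W_{\boldsymbol\omega,\eta}(\rho,\rho')\ge 0$ for all such tuples $\boldsymbol\omega=(\omega_1,\dots,\omega_d)$ and all density matrices $\eta$. (For equal dimensions $d=d'$ the fraction is $\frac{1+\operatorname{Tr}[\eta\rho']}{d+1}$.) -/

import Mathlib

open scoped Kronecker ComplexOrder

noncomputable section

namespace Coherence

/-- Density matrices of size `d`: positive semidefinite complex matrices of trace one. -/
def densityMatrices (d : ℕ) : Set (Matrix (Fin d) (Fin d) ℂ) :=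
  {ρ | ρ.PosSemidef ∧ ρ.trace = 1}

/-- The completely dephasing map: it keeps the diagonal and erases all other entries. -/
def dephasing {d : ℕ} (X : Matrix (Fin d) (Fin d) ℂ) : Matrix (Fin d) (Fin d) ℂ :=
  Matrix.diagonal X.diag

/-- The free states: density matrices that are diagonal in the fixed (standard) basis. -/
def incoherentStates (d : ℕ) : Set (Matrix (Fin d) (Fin d) ℂ) :=
  {σ | σ ∈ densityMatrices d ∧ σ.IsDiag}

/-- Density matrices all of whose diagonal entries are equal to `1 / d`. -/
def uniformDiagonalStates (d : ℕ) : Set (Matrix (Fin d) (Fin d) ℂ) :=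
  {ω | ω ∈ densityMatrices d ∧ dephasing ω = (1 / (d : ℂ)) • 1}

/-- The map `id_k ⊗ Φ`, where `Φ` acts on each `d × d` block of a `k × k` block matrix. -/
def ampliation {d d' : ℕ} (k : ℕ)
    (Φ : Matrix (Fin d) (Fin d) ℂ →ₗ[ℂ] Matrix (Fin d') (Fin d') ℂ)
    (X : Matrix (Fin k × Fin d) (Fin k × Fin d) ℂ) :
    Matrix (Fin k × Fin d') (Fin k × Fin d') ℂ :=
  Matrix.of fun x y => Φ (Matrix.of fun p q => X (x.1, p) (y.1, q)) x.2 y.2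

/-- A quantum channel: a completely positive trace-preserving linear map. -/
structure IsChannel {d d' : ℕ}
    (Φ : Matrix (Fin d) (Fin d) ℂ →ₗ[ℂ] Matrix (Fin d') (Fin d') ℂ) : Prop where
  completely_positive : ∀ (k : ℕ) (X : Matrix (Fin k × Fin d) (Fin k × Fin d) ℂ),
    X.PosSemidef → (ampliation k Φ X).PosSemidef
  trace_preserving : ∀ X : Matrix (Fin d) (Fin d) ℂ, (Φ X).trace = X.trace

/-- A maximally incoherent operation: a channel that maps incoherent states to
incoherent states. -/
structure IsMaximallyIncoherent {d d' : ℕ}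
    (Φ : Matrix (Fin d) (Fin d) ℂ →ₗ[ℂ] Matrix (Fin d') (Fin d') ℂ) : Prop where
  isChannel : IsChannel Φ
  map_incoherent : ∀ σ ∈ incoherentStates d, Φ σ ∈ incoherentStates d'

/-- The state `ρ` can be converted to `ρ'` by a maximally incoherent operation. -/
def Convertible {d d' : ℕ} (ρ : Matrix (Fin d) (Fin d) ℂ)
    (ρ' : Matrix (Fin d') (Fin d') ℂ) : Prop :=
  ∃ Φ : Matrix (Fin d) (Fin d) ℂ →ₗ[ℂ] Matrix (Fin d') (Fin d') ℂ,
    IsMaximallyIncoherent Φ ∧ Φ ρ = ρ'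

/-- The conditional min-entropy `H_min(A|B)` of a bipartite matrix, where `A` is the first
tensor factor, of dimension `a`, and `B` the second, of dimension `b`:
`-log₂ min {Tr τ | τ ≥ 0, I ⊗ τ ≥ Ω}`. -/
def condMinEntropy {a b : ℕ} (Ω : Matrix (Fin a × Fin b) (Fin a × Fin b) ℂ) : ℝ :=
  -Real.logb 2 (sInf {t : ℝ | ∃ τ : Matrix (Fin b) (Fin b) ℂ, τ.PosSemidef ∧
    ((1 : Matrix (Fin a) (Fin a) ℂ) ⊗ₖ τ - Ω).PosSemidef ∧ t = τ.trace.re})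

/-- The bipartite state `Ω = (∑_ℓ ω_ℓ ⊗ |ℓ⟩⟨ℓ| + η ⊗ ρᵀ) / (d + 1)`. -/
def jointState {d d' : ℕ} (ω : Fin d → Matrix (Fin d') (Fin d') ℂ)
    (η : Matrix (Fin d') (Fin d') ℂ) (ρ : Matrix (Fin d) (Fin d) ℂ) :
    Matrix (Fin d' × Fin d) (Fin d' × Fin d) ℂ :=
  (1 / ((d : ℂ) + 1)) • ((∑ l : Fin d, ω l ⊗ₖ Matrix.single l l (1 : ℂ)) + η ⊗ₖ ρ.transpose)

/-- The no-go witness `W_{ω,η}(ρ,ρ') = 2^{-H_min(A|B)_Ω} - (d/d' + Tr[ηρ']) / (d + 1)`. -/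
def witness {d d' : ℕ} (ω : Fin d → Matrix (Fin d') (Fin d') ℂ)
    (η : Matrix (Fin d') (Fin d') ℂ) (ρ : Matrix (Fin d) (Fin d) ℂ)
    (ρ' : Matrix (Fin d') (Fin d') ℂ) : ℝ :=
  (2 : ℝ) ^ (-condMinEntropy (jointState ω η ρ)) -
    ((d : ℝ) / (d' : ℝ) + (η * ρ').trace.re) / ((d : ℝ) + 1)

/-- For equal input and output dimensions the term `d/d'` of the witness is `1`. -/
theorem witness_of_eq_dim {d : ℕ} (hd : d ≠ 0) (ω : Fin d → Matrix (Fin d) (Fin d) ℂ)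
    (η ρ ρ' : Matrix (Fin d) (Fin d) ℂ) :
    witness ω η ρ ρ' = (2 : ℝ) ^ (-condMinEntropy (jointState ω η ρ)) -
      (1 + (η * ρ').trace.re) / ((d : ℝ) + 1) := by
  have h : (d : ℝ) ≠ 0 := Nat.cast_ne_zero.mpr hd
  rw [witness, div_self h]

end Coherence

end

/-! Through the Choi matrix `J`, convertibility is a cone problem: find `J ≥ 0` with partial trace
`1`, diagonal images of the basis projections, and `ρ ↦ ρ'`. The witnesses are its dual
certificates.

Necessity is weak duality (`le_of_mem_feasibleTraces`): pair the Choi matrix of the operation with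
`I ⊗ τ - Ω ≥ 0`.

For sufficiency, the image of the positive semidefinite cone under `constraintMap` is convex, and
closed because the partial trace controls the trace of `J`. If `(1, 0, ρ')` lies outside,
Hahn–Banach gives matrices `T, K, G` with `dualMatrix T K G ρ ≥ 0` and `Tr T + Tr[Gρ'] < 0` in real
parts (`exists_dualMatrix_of_not_mem`). Perturbing the maximally mixed state by small multiples of
`-K l` and of the traceless part of `-G` turns this certificate into states with negative witness
(`exists_witness_neg`). -/

namespace Coherence

/-! ### Positive semidefinite matrices: compactness and trace duality -/

section Matrices

variable {m n : Type*} [Fintype m] [Fintype n]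

open scoped MatrixOrder Matrix.Norms.L2Operator in
theorem exists_eq_conjTranspose_mul_self {A : Matrix n n ℂ} (hA : A.PosSemidef) :
    ∃ B : Matrix n n ℂ, A = B.conjTranspose * B := by
  classical
  exact CStarAlgebra.nonneg_iff_eq_star_mul_self.mp hA.nonneg

open scoped MatrixOrder Matrix.Norms.L2Operator in
theorem exists_posSemidef_smul_one_sub [DecidableEq n] {H : Matrix n n ℂ} (hH : H.IsHermitian) :
    ∃ r : ℝ, ((r : ℂ) • (1 : Matrix n n ℂ) - H).PosSemidef := by
  refine ⟨‖H‖, ?_⟩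
  have h : H ≤ algebraMap ℝ _ ‖H‖ := IsSelfAdjoint.le_algebraMap_norm_self hH
  rwa [Matrix.le_iff, Algebra.algebraMap_eq_smul_one, ← Complex.coe_smul] at h

theorem trace_mul_nonneg_of_posSemidef {A B : Matrix n n ℂ} (hA : A.PosSemidef)
    (hB : B.PosSemidef) : 0 ≤ (A * B).trace := by
  obtain ⟨C, rfl⟩ := exists_eq_conjTranspose_mul_self hA
  rw [Matrix.mul_assoc, Matrix.trace_mul_comm]
  exact (hB.mul_mul_conjTranspose_same C).trace_nonneg

/-- Write `A = B* B` and apply `2xy ≤ x² + y²` to the columns of `B`. This bounds the trace slices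
of the cone, hence makes them compact. -/
theorem norm_apply_le_trace {A : Matrix n n ℂ} (hA : A.PosSemidef) (i j : n) :
    ‖A i j‖ ≤ A.trace.re := by
  have hd : ∀ k, (A k k).re ≤ A.trace.re := fun k => by
    rw [Matrix.trace, Complex.re_sum]
    exact Finset.single_le_sum (f := fun k => (A.diag k).re)
      (fun k _ => (Complex.le_def.mp hA.diag_nonneg).1) (Finset.mem_univ k)
  obtain ⟨B, hB⟩ := exists_eq_conjTranspose_mul_self hA
  have hkk : ∀ k, (A k k).re = ∑ r, ‖B r k‖ ^ 2 := fun k => by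
    rw [hB, Matrix.mul_apply, Complex.re_sum]
    refine Finset.sum_congr rfl fun r _ => ?_
    rw [Matrix.conjTranspose_apply, Complex.star_def, Complex.conj_mul', ← Complex.ofReal_pow,
      Complex.ofReal_re]
  have hij : ‖A i j‖ ≤ ∑ r, ‖B r i‖ * ‖B r j‖ := by
    rw [hB, Matrix.mul_apply]
    refine (norm_sum_le _ _).trans (le_of_eq (Finset.sum_congr rfl fun r _ => ?_))
    rw [norm_mul, Matrix.conjTranspose_apply, norm_star]
  have h2 : 2 * ∑ r, ‖B r i‖ * ‖B r j‖ ≤ (A i i).re + (A j j).re := by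
    rw [hkk, hkk, ← Finset.sum_add_distrib, Finset.mul_sum]
    exact Finset.sum_le_sum fun r _ => by nlinarith [sq_nonneg (‖B r i‖ - ‖B r j‖)]
  linarith [hd i, hd j]

theorem isClosed_posSemidef : IsClosed {A : Matrix n n ℂ | A.PosSemidef} := by
  simp only [Matrix.posSemidef_iff_dotProduct_mulVec, Set.ofPred_and, Set.ofPred_forall]
  refine IsClosed.inter (isClosed_eq (by fun_prop) continuous_id) (isClosed_iInter fun x => ?_)
  exact isClosed_le continuous_const (by fun_prop)

theorem isCompact_posSemidef_trace_le (c : ℝ) :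
    IsCompact {A : Matrix n n ℂ | A.PosSemidef ∧ A.trace.re ≤ c} := by
  have h : IsCompact (Set.univ.pi fun _ : n => Set.univ.pi fun _ : n =>
      Metric.closedBall (0 : ℂ) c) :=
    isCompact_univ_pi fun _ => isCompact_univ_pi fun _ => isCompact_closedBall _ _
  refine IsCompact.of_isClosed_subset (X := Matrix n n ℂ) h
    (isClosed_posSemidef.inter (isClosed_le
      (Complex.continuous_re.comp continuous_id.matrix_trace) continuous_const)) ?_
  rintro A ⟨hA, hc⟩ i - j -
  simpa using (norm_apply_le_trace hA i j).trans hc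

/-- A linear image of the positive semidefinite cone is closed if it determines the trace. -/
theorem isClosed_image_posSemidef {F : Type*} [TopologicalSpace F] [T2Space F]
    {f : Matrix n n ℂ → F} (hf : Continuous f) {g : F → ℝ} (hg : Continuous g)
    (hgf : ∀ A, g (f A) = A.trace.re) : IsClosed (f '' {A | A.PosSemidef}) := by
  -- Near `y` the value of `g` stays below `g y + 1`, so only preimages in a compact trace slice
  -- matter.
  refine isClosed_of_closure_subset fun y hy => ?_
  have hU : IsOpen {z | g z < g y + 1} := isOpen_lt hg continuous_const
  have hy' : y ∈ closure ({z | g z < g y + 1} ∩ f '' {A | A.PosSemidef}) :=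
    hU.inter_closure ⟨by simp, hy⟩
  have hsub : {z | g z < g y + 1} ∩ f '' {A | A.PosSemidef} ⊆
      f '' {A | A.PosSemidef ∧ A.trace.re ≤ g y + 1} := by
    rintro _ ⟨hz, A, hA, rfl⟩
    exact ⟨A, ⟨hA, (hgf A).symm.trans_le (le_of_lt hz)⟩, rfl⟩
  have hcl := ((isCompact_posSemidef_trace_le (n := n) (g y + 1)).image hf).isClosed
  obtain ⟨A, hA, h⟩ := closure_minimal hsub hcl hy'
  exact ⟨A, hA.1, h⟩

theorem exists_trace_mul_eq (φ : Matrix m n ℂ →ₗ[ℂ] ℂ) :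
    ∃ Y : Matrix n m ℂ, ∀ X, φ X = (X * Y).trace := by
  classical
  refine ⟨Matrix.of fun j i => φ (Matrix.single i j 1), fun X => ?_⟩
  conv_lhs => rw [Matrix.matrix_eq_sum_single X]
  simp only [map_sum, Matrix.trace, Matrix.diag_apply, Matrix.mul_apply, Matrix.of_apply]
  refine Finset.sum_congr rfl fun i _ => Finset.sum_congr rfl fun j _ => ?_
  rw [← smul_eq_mul, ← map_smul, Matrix.smul_single, smul_eq_mul, mul_one]

/-- Test on rank-one `J`. Separation controls only real parts, so `M` need not be Hermitian and has
to be symmetrised. -/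
theorem posSemidef_add_conjTranspose {M : Matrix n n ℂ}
    (h : ∀ J : Matrix n n ℂ, J.PosSemidef → 0 ≤ (J * M).trace.re) :
    (M + M.conjTranspose).PosSemidef := by
  refine Matrix.PosSemidef.of_dotProduct_mulVec_nonneg (by
    simp [Matrix.IsHermitian, add_comm]) fun x => ?_
  have hx := h _ (Matrix.posSemidef_vecMulVec_self_star x)
  have h1 : (Matrix.vecMulVec x (star x) * M).trace = star x ⬝ᵥ M.mulVec x := by
    rw [Matrix.vecMulVec_mul, Matrix.trace_vecMulVec, Matrix.dotProduct_mulVec, dotProduct_comm]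
  have h2 : star x ⬝ᵥ M.conjTranspose.mulVec x = star (star x ⬝ᵥ M.mulVec x) := by
    rw [Matrix.star_dotProduct, Matrix.star_mulVec, Matrix.conjTranspose_conjTranspose,
      Matrix.dotProduct_mulVec]
  rw [Matrix.add_mulVec, dotProduct_add, h2, ← h1]
  generalize (Matrix.vecMulVec x (star x) * M).trace = z at hx
  rw [Complex.le_def]
  simp [hx]

theorem eventually_posSemidef_smul_one_sub [DecidableEq n] {H : Matrix n n ℂ}
    (hH : H.IsHermitian) :
    ∀ᶠ c : ℝ in Filter.atTop, ((c : ℂ) • (1 : Matrix n n ℂ) - H).PosSemidef := by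
  obtain ⟨r, hr⟩ := exists_posSemidef_smul_one_sub hH
  filter_upwards [Filter.eventually_ge_atTop r] with c hc
  have h : ((c : ℂ) • (1 : Matrix n n ℂ) - H) =
      ((c - r : ℝ) : ℂ) • (1 : Matrix n n ℂ) + ((r : ℂ) • (1 : Matrix n n ℂ) - H) := by
    push_cast
    module
  rw [h]
  exact (Matrix.PosSemidef.one.smul (by exact_mod_cast sub_nonneg.mpr hc)).add hr

end Matrices

/-! ### Choi matrices and maximally incoherent operations -/

section Choi

variable {d d' : ℕ}

/-- The linear map with Choi matrix `J`. -/
def mapOfChoi (J : Matrix (Fin d' × Fin d) (Fin d' × Fin d) ℂ) :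
    Matrix (Fin d) (Fin d) ℂ →ₗ[ℂ] Matrix (Fin d') (Fin d') ℂ where
  toFun X := Matrix.of fun i j => ∑ p, ∑ q, J (i, p) (j, q) * X p q
  map_add' X Y := by
    ext i j
    simp [mul_add, Finset.sum_add_distrib]
  map_smul' c X := by
    ext i j
    simp [Finset.mul_sum, mul_left_comm]

theorem mapOfChoi_apply (J : Matrix (Fin d' × Fin d) (Fin d' × Fin d) ℂ)
    (X : Matrix (Fin d) (Fin d) ℂ) (i j : Fin d') :
    mapOfChoi J X i j = ∑ p, ∑ q, J (i, p) (j, q) * X p q := rfl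

/-- The Choi matrix of a linear map. -/
def choi (Φ : Matrix (Fin d) (Fin d) ℂ →ₗ[ℂ] Matrix (Fin d') (Fin d') ℂ) :
    Matrix (Fin d' × Fin d) (Fin d' × Fin d) ℂ :=
  Matrix.of fun x y => Φ (Matrix.single x.2 y.2 1) x.1 y.1

theorem mapOfChoi_choi (Φ : Matrix (Fin d) (Fin d) ℂ →ₗ[ℂ] Matrix (Fin d') (Fin d') ℂ) :
    mapOfChoi (choi Φ) = Φ := by
  refine LinearMap.ext fun X => ?_
  ext i j
  conv_rhs => rw [Matrix.matrix_eq_sum_single X]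
  simp only [mapOfChoi_apply, choi, Matrix.of_apply, map_sum, Matrix.sum_apply]
  refine Finset.sum_congr rfl fun p _ => Finset.sum_congr rfl fun q _ => ?_
  rw [show Matrix.single p q (X p q) = X p q • Matrix.single p q (1 : ℂ) by simp, map_smul,
    Matrix.smul_apply, smul_eq_mul, mul_comm]

/-- The partial trace over the first factor. -/
def partialTrace (J : Matrix (Fin d' × Fin d) (Fin d' × Fin d) ℂ) :
    Matrix (Fin d) (Fin d) ℂ :=
  Matrix.of fun p q => ∑ i, J (i, p) (i, q)

theorem trace_partialTrace (J : Matrix (Fin d' × Fin d) (Fin d' × Fin d) ℂ) :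
    (partialTrace J).trace = J.trace := by
  simp only [partialTrace, Matrix.trace, Matrix.diag_apply, Matrix.of_apply,
    Fintype.sum_prod_type]
  exact Finset.sum_comm

theorem trace_mapOfChoi (J : Matrix (Fin d' × Fin d) (Fin d' × Fin d) ℂ)
    (X : Matrix (Fin d) (Fin d) ℂ) :
    (mapOfChoi J X).trace = (partialTrace J * X.transpose).trace := by
  simp only [partialTrace, Matrix.trace, Matrix.diag_apply, Matrix.of_apply, mapOfChoi_apply,
    Matrix.mul_apply, Matrix.transpose_apply, Finset.sum_mul]
  rw [Finset.sum_comm]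
  exact Finset.sum_congr rfl fun p _ => Finset.sum_comm

/-- The duality identity behind every pairing below; it is the source of the transpose on `ρ` in
`Ω`. -/
theorem trace_mul_kronecker_transpose (J : Matrix (Fin d' × Fin d) (Fin d' × Fin d) ℂ)
    (X : Matrix (Fin d') (Fin d') ℂ) (σ : Matrix (Fin d) (Fin d) ℂ) :
    (J * (X ⊗ₖ σ.transpose)).trace = (mapOfChoi J σ * X).trace := by
  simp only [Matrix.trace, Matrix.diag_apply, mapOfChoi_apply, Matrix.mul_apply,
    Matrix.kroneckerMap_apply, Matrix.transpose_apply, Finset.sum_mul, Fintype.sum_prod_type]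
  refine Finset.sum_congr rfl fun i _ => ?_
  rw [Finset.sum_comm]
  refine Finset.sum_congr rfl fun j _ => Finset.sum_congr rfl fun p _ =>
    Finset.sum_congr rfl fun q _ => by ring

theorem trace_mul_one_kronecker (J : Matrix (Fin d' × Fin d) (Fin d' × Fin d) ℂ)
    (T : Matrix (Fin d) (Fin d) ℂ) :
    (J * ((1 : Matrix (Fin d') (Fin d') ℂ) ⊗ₖ T)).trace = (partialTrace J * T).trace := by
  have h := trace_mul_kronecker_transpose J 1 T.transpose
  rwa [Matrix.transpose_transpose, mul_one, trace_mapOfChoi, Matrix.transpose_transpose] at h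

theorem trace_mul_kronecker_single (J : Matrix (Fin d' × Fin d) (Fin d' × Fin d) ℂ)
    (X : Matrix (Fin d') (Fin d') ℂ) (l : Fin d) :
    (J * (X ⊗ₖ Matrix.single l l (1 : ℂ))).trace =
      (mapOfChoi J (Matrix.single l l 1) * X).trace := by
  rw [← trace_mul_kronecker_transpose, Matrix.transpose_single]

theorem posSemidef_ampliation_mapOfChoi {J : Matrix (Fin d' × Fin d) (Fin d' × Fin d) ℂ}
    (hJ : J.PosSemidef) (k : ℕ) {X : Matrix (Fin k × Fin d) (Fin k × Fin d) ℂ}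
    (hX : X.PosSemidef) : (ampliation k (mapOfChoi J) X).PosSemidef := by
  -- `N` is the principal submatrix of `J ⊗ X` on which the two input indices agree; compressing by
  -- `W` sums over that index and yields the ampliation.
  let N : Matrix ((Fin k × Fin d') × Fin d) ((Fin k × Fin d') × Fin d) ℂ :=
    (J ⊗ₖ X).submatrix (fun x => ((x.1.2, x.2), (x.1.1, x.2)))
      (fun x => ((x.1.2, x.2), (x.1.1, x.2)))
  let W : Matrix ((Fin k × Fin d') × Fin d) (Fin k × Fin d') ℂ :=
    Matrix.of fun x y => if x.1 = y then 1 else 0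
  have hN : N.PosSemidef := (hJ.kronecker hX).submatrix _
  have h := hN.conjTranspose_mul_mul_same W
  convert h using 1
  ext x y
  simp only [ampliation, Matrix.of_apply, mapOfChoi_apply, W, N, Matrix.mul_apply,
    Matrix.conjTranspose_apply, Matrix.submatrix_apply, Matrix.kroneckerMap_apply,
    Fintype.sum_prod_type (α₁ := Fin k × Fin d'), mul_ite, mul_one, mul_zero]
  simp only [apply_ite star, star_one, star_zero, ite_mul, one_mul, zero_mul,
    Finset.sum_ite_irrel, Finset.sum_const_zero, Finset.sum_ite_eq', Finset.mem_univ, if_true]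
  exact Finset.sum_comm

theorem isChannel_mapOfChoi {J : Matrix (Fin d' × Fin d) (Fin d' × Fin d) ℂ}
    (hJ : J.PosSemidef) (htr : partialTrace J = 1) : IsChannel (mapOfChoi J) where
  completely_positive k _ hX := posSemidef_ampliation_mapOfChoi hJ k hX
  trace_preserving X := by rw [trace_mapOfChoi, htr, one_mul, Matrix.trace_transpose]

/-- Up to swapping factors, the Choi matrix is the ampliation of the unnormalised maximally
entangled projection. -/
theorem IsChannel.posSemidef_choi
    {Φ : Matrix (Fin d) (Fin d) ℂ →ₗ[ℂ] Matrix (Fin d') (Fin d') ℂ} (hΦ : IsChannel Φ) :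
    (choi Φ).PosSemidef := by
  let v : Fin d × Fin d → ℂ := fun x => if x.1 = x.2 then 1 else 0
  have h := hΦ.completely_positive d _ (Matrix.posSemidef_vecMulVec_self_star v)
  convert h.submatrix (fun x : Fin d' × Fin d => (x.2, x.1)) using 1
  ext ⟨i, p⟩ ⟨j, q⟩
  simp only [choi, ampliation, Matrix.of_apply, Matrix.submatrix_apply]
  refine congrArg (fun X => Φ X i j) ?_
  ext a b
  simp only [Matrix.single_apply, Matrix.of_apply, Matrix.vecMulVec_apply, v, Pi.star_apply]
  split_ifs <;> simp_all

theorem IsChannel.posSemidef_apply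
    {Φ : Matrix (Fin d) (Fin d) ℂ →ₗ[ℂ] Matrix (Fin d') (Fin d') ℂ} (hΦ : IsChannel Φ)
    {X : Matrix (Fin d) (Fin d) ℂ} (hX : X.PosSemidef) : (Φ X).PosSemidef :=
  (hΦ.completely_positive 1 _ (hX.submatrix (Prod.snd : Fin 1 × Fin d → Fin d))).submatrix
    (fun i : Fin d' => ((0 : Fin 1), i))

theorem single_mem_incoherentStates (l : Fin d) :
    Matrix.single l l (1 : ℂ) ∈ incoherentStates d := by
  rw [← Matrix.diagonal_single]
  refine ⟨⟨Matrix.PosSemidef.diagonal (Pi.single_nonneg.mpr zero_le_one), ?_⟩,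
    Matrix.isDiag_diagonal _⟩
  rw [Matrix.trace_diagonal, Finset.sum_pi_single']
  simp

theorem IsChannel.isMaximallyIncoherent
    {Φ : Matrix (Fin d) (Fin d) ℂ →ₗ[ℂ] Matrix (Fin d') (Fin d') ℂ} (hΦ : IsChannel Φ)
    (h : ∀ l, (Φ (Matrix.single l l 1)).IsDiag) : IsMaximallyIncoherent Φ := by
  refine ⟨hΦ, fun σ hσ => ⟨⟨hΦ.posSemidef_apply hσ.1.1, ?_⟩, fun i j hij => ?_⟩⟩
  · rw [hΦ.trace_preserving, hσ.1.2]
  · have hdiag : σ = ∑ l, σ l l • Matrix.single l l (1 : ℂ) := by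
      conv_lhs => rw [← hσ.2.diagonal_diag]
      ext a b
      simp [Matrix.sum_apply, Matrix.diagonal_apply, Matrix.single_apply, ite_and]
    change Φ σ i j = 0
    rw [hdiag, map_sum, Matrix.sum_apply]
    refine Finset.sum_eq_zero fun l _ => ?_
    rw [map_smul, Matrix.smul_apply, h l hij, smul_zero]

end Choi

/-! ### Separating the target from the cone of attainable data -/

section Separation

variable {d d' : ℕ}

instance : LocallyConvexSpace ℝ (Matrix (Fin d) (Fin d) ℂ) :=
  inferInstanceAs (LocallyConvexSpace ℝ (Fin d → Fin d → ℂ))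

/-- The matrix `I ⊗ T + ∑_l K_l ⊗ |l⟩⟨l| + G ⊗ ρᵀ`. -/
def dualMatrix (T : Matrix (Fin d) (Fin d) ℂ) (K : Fin d → Matrix (Fin d') (Fin d') ℂ)
    (G : Matrix (Fin d') (Fin d') ℂ) (ρ : Matrix (Fin d) (Fin d) ℂ) :
    Matrix (Fin d' × Fin d) (Fin d' × Fin d) ℂ :=
  (1 : Matrix (Fin d') (Fin d') ℂ) ⊗ₖ T + ∑ l, K l ⊗ₖ Matrix.single l l (1 : ℂ) +
    G ⊗ₖ ρ.transpose

theorem trace_mul_dualMatrix (J : Matrix (Fin d' × Fin d) (Fin d' × Fin d) ℂ)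
    (T : Matrix (Fin d) (Fin d) ℂ) (K : Fin d → Matrix (Fin d') (Fin d') ℂ)
    (G : Matrix (Fin d') (Fin d') ℂ) (ρ : Matrix (Fin d) (Fin d) ℂ) :
    (J * dualMatrix T K G ρ).trace = (partialTrace J * T).trace +
      ∑ l, (mapOfChoi J (Matrix.single l l 1) * K l).trace + (mapOfChoi J ρ * G).trace := by
  simp only [dualMatrix, mul_add, Matrix.trace_add, Matrix.mul_sum, Matrix.trace_sum,
    trace_mul_one_kronecker, trace_mul_kronecker_single, trace_mul_kronecker_transpose]

theorem dualMatrix_add_conjTranspose (T : Matrix (Fin d) (Fin d) ℂ)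
    (K : Fin d → Matrix (Fin d') (Fin d') ℂ) (G : Matrix (Fin d') (Fin d') ℂ)
    {ρ : Matrix (Fin d) (Fin d) ℂ} (hρ : ρ.IsHermitian) :
    dualMatrix T K G ρ + (dualMatrix T K G ρ).conjTranspose =
      dualMatrix (T + T.conjTranspose) (fun l => K l + (K l).conjTranspose)
        (G + G.conjTranspose) ρ := by
  simp only [dualMatrix, Matrix.conjTranspose_add, Matrix.conjTranspose_sum,
    Matrix.conjTranspose_kronecker, Matrix.conjTranspose_one, Matrix.conjTranspose_single,
    star_one, hρ.transpose.eq, Matrix.kronecker_add, Matrix.add_kronecker,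
    Finset.sum_add_distrib]
  abel

/-- The linear data of the map with Choi matrix `J` that have to be prescribed: its partial
trace, the off-diagonal parts of the images of the basis projections, the image of `ρ`. -/
def constraintMap (ρ : Matrix (Fin d) (Fin d) ℂ)
    (J : Matrix (Fin d' × Fin d) (Fin d' × Fin d) ℂ) :
    Matrix (Fin d) (Fin d) ℂ × (Fin d → Matrix (Fin d') (Fin d') ℂ) ×
      Matrix (Fin d') (Fin d') ℂ :=
  (partialTrace J, fun l => mapOfChoi J (Matrix.single l l 1) -
    dephasing (mapOfChoi J (Matrix.single l l 1)), mapOfChoi J ρ)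

theorem constraintMap_add (ρ : Matrix (Fin d) (Fin d) ℂ)
    (J J' : Matrix (Fin d' × Fin d) (Fin d' × Fin d) ℂ) :
    constraintMap ρ (J + J') = constraintMap ρ J + constraintMap ρ J' := by
  have hm : ∀ X, mapOfChoi (J + J') X = mapOfChoi J X + mapOfChoi J' X := fun X => by
    ext i j
    simp [mapOfChoi_apply, add_mul, Finset.sum_add_distrib]
  refine Prod.ext ?_ (Prod.ext (funext fun l => ?_) (hm ρ))
  · ext p q
    simp [constraintMap, partialTrace, Finset.sum_add_distrib]
  · change mapOfChoi (J + J') _ - dephasing (mapOfChoi (J + J') _) =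
      (mapOfChoi J _ - dephasing _) + (mapOfChoi J' _ - dephasing _)
    rw [hm, dephasing, dephasing, dephasing, Matrix.diag_add, sub_add_sub_comm]
    exact congrArg _ (Matrix.diagonal_add _ _).symm

theorem constraintMap_smul (ρ : Matrix (Fin d) (Fin d) ℂ) (c : ℝ)
    (J : Matrix (Fin d' × Fin d) (Fin d' × Fin d) ℂ) :
    constraintMap ρ (c • J) = c • constraintMap ρ J := by
  have hm : ∀ X, mapOfChoi (c • J) X = c • mapOfChoi J X := fun X => by
    ext i j
    simp [mapOfChoi_apply, Finset.mul_sum, mul_assoc]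
  refine Prod.ext ?_ (Prod.ext (funext fun l => ?_) (hm ρ))
  · ext p q
    simp [constraintMap, partialTrace, Finset.mul_sum]
  · change mapOfChoi (c • J) _ - dephasing (mapOfChoi (c • J) _) =
      c • (mapOfChoi J _ - dephasing _)
    rw [hm, dephasing, dephasing, Matrix.diag_smul, Matrix.diagonal_smul, smul_sub]

theorem continuous_constraintMap (ρ : Matrix (Fin d) (Fin d) ℂ) :
    Continuous (constraintMap (d' := d') ρ) := by
  have hm : ∀ X, Continuous fun J : Matrix (Fin d' × Fin d) (Fin d' × Fin d) ℂ =>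
      mapOfChoi J X := fun X => by
    refine continuous_matrix fun i j => ?_
    simp only [mapOfChoi_apply]
    fun_prop
  refine Continuous.prodMk (continuous_matrix fun p q => ?_)
    (Continuous.prodMk (continuous_pi fun l => ?_) (hm ρ))
  · simp only [partialTrace, Matrix.of_apply]
    fun_prop
  · exact (hm _).sub (hm _).matrix_diag.matrix_diagonal

/-- Dephasing is self-adjoint for the trace pairing, so the dual variables `K l` may be taken with
zero diagonal. -/
theorem trace_sub_dephasing_mul (X H : Matrix (Fin d) (Fin d) ℂ) :
    ((X - dephasing X) * H).trace = (X * (H - dephasing H)).trace := by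
  rw [Matrix.sub_mul, Matrix.mul_sub, Matrix.trace_sub, Matrix.trace_sub, dephasing, dephasing]
  congr 1
  simp [Matrix.trace, Matrix.diagonal_mul, Matrix.mul_diagonal]

theorem exists_dualMatrix_of_not_mem {ρ : Matrix (Fin d) (Fin d) ℂ} (hρ : ρ.IsHermitian)
    {ρ' : Matrix (Fin d') (Fin d') ℂ} (hρ' : ρ'.IsHermitian)
    (h : ((1, 0, ρ') : Matrix (Fin d) (Fin d) ℂ × (Fin d → Matrix (Fin d') (Fin d') ℂ) ×
      Matrix (Fin d') (Fin d') ℂ) ∉ constraintMap ρ '' {J | J.PosSemidef}) :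
    ∃ (T : Matrix (Fin d) (Fin d) ℂ) (K : Fin d → Matrix (Fin d') (Fin d') ℂ)
      (G : Matrix (Fin d') (Fin d') ℂ), (∀ l, (K l).IsHermitian) ∧ (∀ l, dephasing (K l) = 0) ∧
      G.IsHermitian ∧ (dualMatrix T K G ρ).PosSemidef ∧ T.trace.re + (G * ρ').trace.re < 0 := by
  have hclosed : IsClosed (constraintMap (d' := d') ρ '' {J | J.PosSemidef}) :=
    isClosed_image_posSemidef (continuous_constraintMap ρ)
      (g := fun z => z.1.trace.re)
      (Complex.continuous_re.comp continuous_fst.matrix_trace)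
      fun J => by rw [constraintMap, trace_partialTrace]
  have hconv : Convex ℝ (constraintMap (d' := d') ρ '' {J | J.PosSemidef}) := by
    rintro _ ⟨J, hJ, rfl⟩ _ ⟨J', hJ', rfl⟩ a b ha hb -
    exact ⟨a • J + b • J', (hJ.smul ha).add (hJ'.smul hb), by
      rw [constraintMap_add, constraintMap_smul, constraintMap_smul]⟩
  obtain ⟨f, u, hu, hf⟩ := RCLike.geometric_hahn_banach_point_closed (𝕜 := ℂ) hconv hclosed h
  have hu0 : u < 0 := by
    have h0 := hf _ ⟨0, Matrix.PosSemidef.zero, rfl⟩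
    rw [show constraintMap (d' := d') ρ 0 = 0 by
      simpa using constraintMap_smul (d' := d') ρ 0 0, map_zero] at h0
    simpa using h0
  -- On a cone, a negative value `r` could be rescaled to exactly `u`, against the strict
  -- separation.
  have hpos : ∀ J : Matrix (Fin d' × Fin d) (Fin d' × Fin d) ℂ, J.PosSemidef →
      0 ≤ (f (constraintMap ρ J)).re := fun J hJ => by
    by_contra! hneg
    set r := (f (constraintMap ρ J)).re with hr
    have hs := hf _ ⟨(u / r) • J, hJ.smul (div_nonneg_of_nonpos hu0.le hneg.le), rfl⟩
    rw [constraintMap_smul, ← Complex.coe_smul, map_smul, smul_eq_mul, RCLike.re_eq_complex_re,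
      Complex.re_ofReal_mul, ← hr, div_mul_cancel₀ _ hneg.ne] at hs
    exact lt_irrefl _ hs
  obtain ⟨T, hT⟩ := exists_trace_mul_eq (f.toLinearMap ∘ₗ LinearMap.inl ℂ _ _)
  obtain ⟨G, hG⟩ := exists_trace_mul_eq
    (f.toLinearMap ∘ₗ LinearMap.inr ℂ _ _ ∘ₗ LinearMap.inr ℂ _ _)
  have hK := fun l => exists_trace_mul_eq
    (f.toLinearMap ∘ₗ LinearMap.inr ℂ _ _ ∘ₗ LinearMap.inl ℂ _ _ ∘ₗ LinearMap.single ℂ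
      (fun _ : Fin d => Matrix (Fin d') (Fin d') ℂ) l)
  choose K hK using hK
  simp only [LinearMap.comp_apply, LinearMap.inl_apply, LinearMap.inr_apply,
    ContinuousLinearMap.coe_coe, LinearMap.single_apply] at hT hG hK
  have hfz : ∀ A B C, f (A, B, C) = (A * T).trace + ∑ l, (B l * K l).trace + (C * G).trace := by
    intro A B C
    have hB : f (0, B, 0) = ∑ l, (B l * K l).trace := by
      simp only [← hK, ← map_sum]
      congr 1
      refine Prod.ext (by simp [Prod.fst_sum])
        (Prod.ext ?_ (by simp [Prod.snd_sum]))
      simp only [Prod.fst_sum, Prod.snd_sum]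
      exact (Finset.univ_sum_single B).symm
    rw [← hT, ← hG, ← hB, ← map_add, ← map_add]
    simp
  have hfJ : ∀ J, f (constraintMap ρ J) =
      (J * dualMatrix T (fun l => K l - dephasing (K l)) G ρ).trace := fun J => by
    simp only [constraintMap, hfz, trace_mul_dualMatrix, trace_sub_dephasing_mul]
  -- Symmetrising makes the certificate Hermitian and merely doubles the separating value, since `ρ`
  -- and `ρ'` are Hermitian.
  refine ⟨T + T.conjTranspose,
    fun l => (K l - dephasing (K l)) + (K l - dephasing (K l)).conjTranspose,
    G + G.conjTranspose, fun l => Matrix.isHermitian_add_transpose_self _, fun l => ?_,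
    Matrix.isHermitian_add_transpose_self _, ?_, ?_⟩
  · rw [dephasing, Matrix.diagonal_eq_zero]
    ext i
    simp [dephasing]
  · rw [← dualMatrix_add_conjTranspose _ _ _ hρ]
    exact posSemidef_add_conjTranspose fun J hJ => hfJ J ▸ hpos J hJ
  · have h1 : (G.conjTranspose * ρ').trace = star (ρ' * G).trace := by
      rw [← Matrix.trace_conjTranspose, Matrix.conjTranspose_mul, hρ'.eq]
    rw [hfz] at hu
    simp only [one_mul, Pi.zero_apply, zero_mul, Matrix.trace_zero, Finset.sum_const_zero,
      add_zero, RCLike.re_eq_complex_re, Complex.add_re] at hu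
    rw [Matrix.add_mul, Matrix.trace_add, Matrix.trace_add, h1, Matrix.trace_conjTranspose,
      Matrix.trace_mul_comm G]
    simp only [Complex.add_re, Complex.star_def, Complex.conj_re]
    linarith

end Separation

/-! ### From dual certificates to witnesses -/

section Witness

variable {d d' : ℕ}

theorem pos_of_mem_densityMatrices {ρ : Matrix (Fin d) (Fin d) ℂ}
    (hρ : ρ ∈ densityMatrices d) : 0 < d := by
  rcases Nat.eq_zero_or_pos d with rfl | h
  · simpa [Matrix.trace] using hρ.2
  · exact h

/-- The feasible values of the semidefinite program that defines `condMinEntropy`. -/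
def feasibleTraces {a b : ℕ} (Ω : Matrix (Fin a × Fin b) (Fin a × Fin b) ℂ) : Set ℝ :=
  {t : ℝ | ∃ τ : Matrix (Fin b) (Fin b) ℂ, τ.PosSemidef ∧
    ((1 : Matrix (Fin a) (Fin a) ℂ) ⊗ₖ τ - Ω).PosSemidef ∧ t = τ.trace.re}

theorem trace_le_of_mem_feasibleTraces {a b : ℕ}
    {Ω : Matrix (Fin a × Fin b) (Fin a × Fin b) ℂ} {t : ℝ} (ht : t ∈ feasibleTraces Ω) :
    Ω.trace.re ≤ a * t := by
  obtain ⟨τ, -, h, rfl⟩ := ht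
  have h' := (Complex.le_def.mp h.trace_nonneg).1
  simp only [Matrix.trace_sub, Matrix.trace_kronecker, Matrix.trace_one, Fintype.card_fin,
    Complex.sub_re, Complex.zero_re, ← Complex.ofReal_natCast, Complex.re_ofReal_mul] at h'
  linarith

theorem feasibleTraces_nonempty {a b : ℕ} {Ω : Matrix (Fin a × Fin b) (Fin a × Fin b) ℂ}
    (hΩ : Ω.IsHermitian) : (feasibleTraces Ω).Nonempty := by
  obtain ⟨c, hc, hc0⟩ := ((eventually_posSemidef_smul_one_sub hΩ).and
    (Filter.eventually_ge_atTop 0)).exists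
  exact ⟨_, (c : ℂ) • 1, Matrix.PosSemidef.one.smul (by exact_mod_cast hc0), by
    rwa [Matrix.kronecker_smul, Matrix.one_kronecker_one], rfl⟩

/-- Positive trace keeps the infimum positive, so the exponential really inverts the logarithm. -/
theorem two_rpow_neg_condMinEntropy {a b : ℕ} (ha : 0 < a)
    {Ω : Matrix (Fin a × Fin b) (Fin a × Fin b) ℂ} (hΩ : Ω.IsHermitian)
    (htr : 0 < Ω.trace.re) :
    (2 : ℝ) ^ (-condMinEntropy Ω) = sInf (feasibleTraces Ω) := by
  have ha' : (0 : ℝ) < a := Nat.cast_pos.mpr ha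
  have hpos : 0 < sInf (feasibleTraces Ω) := by
    refine (div_pos htr ha').trans_le (le_csInf (feasibleTraces_nonempty hΩ) fun t ht => ?_)
    rw [div_le_iff₀' ha']
    exact trace_le_of_mem_feasibleTraces ht
  rw [condMinEntropy, neg_neg]
  exact Real.rpow_logb two_pos (by norm_num) hpos

theorem one_div_succ_nonneg (d : ℕ) : (0 : ℂ) ≤ 1 / ((d : ℂ) + 1) := by
  have h : (0 : ℝ) ≤ 1 / ((d : ℝ) + 1) := by positivity
  simpa using Complex.zero_le_real.mpr h

theorem posSemidef_jointState {ω : Fin d → Matrix (Fin d') (Fin d') ℂ}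
    (hω : ∀ l, (ω l).PosSemidef) {η : Matrix (Fin d') (Fin d') ℂ} (hη : η.PosSemidef)
    {ρ : Matrix (Fin d) (Fin d) ℂ} (hρ : ρ.PosSemidef) : (jointState ω η ρ).PosSemidef := by
  refine Matrix.PosSemidef.smul ((Matrix.posSemidef_sum _ fun l _ =>
    (hω l).kronecker (single_mem_incoherentStates l).1.1).add (hη.kronecker hρ.transpose)) ?_
  exact one_div_succ_nonneg d

theorem trace_jointState {ω : Fin d → Matrix (Fin d') (Fin d') ℂ}
    (hω : ∀ l, (ω l).trace = 1) {η : Matrix (Fin d') (Fin d') ℂ} (hη : η.trace = 1)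
    {ρ : Matrix (Fin d) (Fin d) ℂ} (hρ : ρ.trace = 1) : (jointState ω η ρ).trace = 1 := by
  have h : (d : ℂ) + 1 ≠ 0 := Nat.cast_add_one_ne_zero d
  simp [jointState, Matrix.trace_smul, Matrix.trace_add, Matrix.trace_sum,
    Matrix.trace_kronecker, hω, hη, hρ]
  field_simp

theorem witness_eq_sInf {ω : Fin d → Matrix (Fin d') (Fin d') ℂ}
    (hω : ∀ l, ω l ∈ densityMatrices d') {η : Matrix (Fin d') (Fin d') ℂ}
    (hη : η ∈ densityMatrices d') {ρ : Matrix (Fin d) (Fin d) ℂ} (hρ : ρ ∈ densityMatrices d)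
    (ρ' : Matrix (Fin d') (Fin d') ℂ) :
    witness ω η ρ ρ' = sInf (feasibleTraces (jointState ω η ρ)) -
      ((d : ℝ) / (d' : ℝ) + (η * ρ').trace.re) / ((d : ℝ) + 1) := by
  rw [witness, two_rpow_neg_condMinEntropy (pos_of_mem_densityMatrices hη)
    (posSemidef_jointState (fun l => (hω l).1) hη.1 hρ.1).1]
  rw [trace_jointState (fun l => (hω l).2) hη.2 hρ.2]
  exact one_pos

/-- A diagonal `X` sees only the diagonal of `ω`, which is constant. -/
theorem trace_mul_of_isDiag {X ω : Matrix (Fin d') (Fin d') ℂ} (hX : X.IsDiag)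
    (htr : X.trace = 1) (hω : dephasing ω = (1 / (d' : ℂ)) • 1) :
    (X * ω).trace = 1 / (d' : ℂ) := by
  have hd : ∀ i, ω i i = 1 / (d' : ℂ) := fun i => by
    simpa [dephasing] using congrFun (congrFun hω i) i
  rw [← hX.diagonal_diag, Matrix.trace]
  simp only [Matrix.diag_apply, Matrix.diagonal_mul, hd, ← Finset.sum_mul]
  exact (congrArg (· * (1 / (d' : ℂ))) htr).trans (one_mul _)

/-- Weak duality: against the Choi matrix, `I ⊗ τ` gives `Tr τ` by trace preservation, each `ω l`
term gives `1/d'` by incoherence, and the `η` term gives `Tr[η Φ(ρ)]`. -/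
theorem le_of_mem_feasibleTraces {ω : Fin d → Matrix (Fin d') (Fin d') ℂ}
    (hω : ∀ l, dephasing (ω l) = (1 / (d' : ℂ)) • 1) (η : Matrix (Fin d') (Fin d') ℂ)
    (ρ : Matrix (Fin d) (Fin d) ℂ)
    {Φ : Matrix (Fin d) (Fin d) ℂ →ₗ[ℂ] Matrix (Fin d') (Fin d') ℂ}
    (hΦ : IsMaximallyIncoherent Φ) {t : ℝ} (ht : t ∈ feasibleTraces (jointState ω η ρ)) :
    ((d : ℝ) / (d' : ℝ) + (η * Φ ρ).trace.re) / ((d : ℝ) + 1) ≤ t := by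
  obtain ⟨τ, -, hτ, rfl⟩ := ht
  have h := trace_mul_nonneg_of_posSemidef hΦ.isChannel.posSemidef_choi hτ
  have h1 : (choi Φ * ((1 : Matrix (Fin d') (Fin d') ℂ) ⊗ₖ τ)).trace = τ.trace := by
    rw [← Matrix.transpose_transpose τ, trace_mul_kronecker_transpose, mapOfChoi_choi, mul_one,
      hΦ.isChannel.trace_preserving, Matrix.trace_transpose, Matrix.transpose_transpose]
  have h2 : ∀ l, (choi Φ * (ω l ⊗ₖ Matrix.single l l (1 : ℂ))).trace = 1 / (d' : ℂ) := by
    intro l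
    have hl := hΦ.map_incoherent _ (single_mem_incoherentStates l)
    rw [trace_mul_kronecker_single, mapOfChoi_choi]
    exact trace_mul_of_isDiag hl.2 hl.1.2 (hω l)
  rw [Matrix.mul_sub, Matrix.trace_sub, h1, jointState, Matrix.mul_smul, Matrix.trace_smul,
    Matrix.mul_add, Matrix.trace_add, Matrix.mul_sum, Matrix.trace_sum,
    trace_mul_kronecker_transpose, mapOfChoi_choi, Finset.sum_congr rfl fun l _ => h2 l,
    Finset.sum_const, Finset.card_univ, Fintype.card_fin, Matrix.trace_mul_comm] at h
  have h' := (Complex.le_def.mp h).1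
  rw [show (1 / ((d : ℂ) + 1)) = ((1 / ((d : ℝ) + 1) : ℝ) : ℂ) by push_cast; rfl,
    show d • (1 / (d' : ℂ)) = (((d : ℝ) / d' : ℝ) : ℂ) by
      push_cast; rw [nsmul_eq_mul, mul_one_div],
    Complex.sub_re, smul_eq_mul, Complex.re_ofReal_mul, Complex.add_re, Complex.ofReal_re,
    Complex.zero_re] at h'
  rw [div_eq_inv_mul, ← one_div]
  linarith

/-- The uniform state `1 / d'`, perturbed by a small traceless matrix, is a state. -/
theorem uniform_sub_smul_mem_densityMatrices (hd' : 0 < d') {H : Matrix (Fin d') (Fin d') ℂ}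
    (htr : H.trace = 0) {ε : ℝ}
    (h : (((1 / d' : ℝ) : ℂ) • (1 : Matrix (Fin d') (Fin d') ℂ) - (ε : ℂ) • H).PosSemidef) :
    (1 / (d' : ℂ)) • 1 - (ε : ℂ) • H ∈ densityMatrices d' := by
  have hd : (d' : ℂ) ≠ 0 := by exact_mod_cast hd'.ne'
  refine ⟨by simpa using h, ?_⟩
  simp [Matrix.trace_sub, Matrix.trace_smul, htr, hd]

theorem eventually_posSemidef_uniform_sub (hd' : 0 < d') {H : Matrix (Fin d') (Fin d') ℂ}
    (hH : H.IsHermitian) : ∀ᶠ ε : ℝ in nhdsWithin 0 (Set.Ioi 0),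
      (((1 / d' : ℝ) : ℂ) • (1 : Matrix (Fin d') (Fin d') ℂ) - (ε : ℂ) • H).PosSemidef := by
  have hd : (0 : ℝ) < d' := Nat.cast_pos.mpr hd'
  -- Dividing by `ε` reduces the claim to `c • 1 - H ≥ 0` with `c = 1/(d' ε)` large.
  have hlim : Filter.Tendsto (fun ε : ℝ => (1 / d' : ℝ) * ε⁻¹) (nhdsWithin 0 (Set.Ioi 0))
      Filter.atTop := tendsto_inv_nhdsGT_zero.const_mul_atTop (by positivity)
  filter_upwards [hlim.eventually (eventually_posSemidef_smul_one_sub hH), self_mem_nhdsWithin]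
    with ε h hε
  have hε' : (0 : ℝ) < ε := hε
  have h' := h.smul (a := (ε : ℂ)) (by exact_mod_cast hε'.le)
  rwa [smul_sub, smul_smul, ← Complex.ofReal_mul, mul_comm ε, mul_assoc,
    inv_mul_cancel₀ hε'.ne', mul_one] at h'

theorem posSemidef_of_one_kronecker {a b : ℕ} (ha : 0 < a) {τ : Matrix (Fin b) (Fin b) ℂ}
    (h : ((1 : Matrix (Fin a) (Fin a) ℂ) ⊗ₖ τ).PosSemidef) : τ.PosSemidef := by
  convert h.submatrix (fun i : Fin b => ((⟨0, ha⟩ : Fin a), i)) using 1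
  ext i j
  simp

/-- A dual certificate yields states whose witness is negative. -/
theorem exists_witness_neg (hd' : 0 < d') {ρ : Matrix (Fin d) (Fin d) ℂ}
    (hρ : ρ ∈ densityMatrices d) {ρ' : Matrix (Fin d') (Fin d') ℂ}
    (hρ' : ρ' ∈ densityMatrices d') {T : Matrix (Fin d) (Fin d) ℂ}
    {K : Fin d → Matrix (Fin d') (Fin d') ℂ} {G : Matrix (Fin d') (Fin d') ℂ}
    (hK : ∀ l, (K l).IsHermitian) (hK0 : ∀ l, dephasing (K l) = 0) (hG : G.IsHermitian)
    (hpos : (dualMatrix T K G ρ).PosSemidef) (hneg : T.trace.re + (G * ρ').trace.re < 0) :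
    ∃ ω : Fin d → Matrix (Fin d') (Fin d') ℂ, (∀ l, ω l ∈ uniformDiagonalStates d') ∧
      ∃ η ∈ densityMatrices d', witness ω η ρ ρ' < 0 := by
  have hdC : (d' : ℂ) ≠ 0 := by exact_mod_cast hd'.ne'
  have hdR : (d' : ℝ) ≠ 0 := by exact_mod_cast hd'.ne'
  have hd1 : (d : ℂ) + 1 ≠ 0 := Nat.cast_add_one_ne_zero d
  obtain ⟨g, hg⟩ : ∃ g : ℝ, G.trace = g := by
    refine ⟨G.trace.re, (Complex.conj_eq_iff_re.mp ?_).symm⟩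
    rw [← Complex.star_def, ← Matrix.trace_conjTranspose, hG.eq]
  -- `η` must have trace one, so only the traceless part of `G` perturbs it; the trace `g` is
  -- absorbed into `τ`.
  set G₀ : Matrix (Fin d') (Fin d') ℂ := G - ((g / d' : ℝ) : ℂ) • 1 with hG₀
  have hG₀H : G₀.IsHermitian := hG.sub (by
    rw [Matrix.IsHermitian, Matrix.conjTranspose_smul, Complex.star_def, Complex.conj_ofReal,
      Matrix.conjTranspose_one])
  have hG₀tr : G₀.trace = 0 := by
    simp [hG₀, Matrix.trace_sub, Matrix.trace_smul, hg, hdC]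
  obtain ⟨ε, ⟨hεK, hεG⟩, hε⟩ := (((Filter.eventually_all.mpr fun l =>
    eventually_posSemidef_uniform_sub hd' (hK l)).and
    (eventually_posSemidef_uniform_sub hd' hG₀H)).and self_mem_nhdsWithin).exists
  replace hε : (0 : ℝ) < ε := hε
  have hKtr : ∀ l, (K l).trace = 0 := fun l => by
    have h := congrArg Matrix.trace (hK0 l)
    rwa [dephasing, Matrix.trace_diagonal, Matrix.trace_zero] at h
  set ω : Fin d → Matrix (Fin d') (Fin d') ℂ := fun l =>
    (1 / (d' : ℂ)) • 1 - (ε : ℂ) • K l with hω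
  set η : Matrix (Fin d') (Fin d') ℂ := (1 / (d' : ℂ)) • 1 - (ε : ℂ) • G₀ with hη
  have hωmem : ∀ l, ω l ∈ densityMatrices d' := fun l =>
    uniform_sub_smul_mem_densityMatrices hd' (hKtr l) (hεK l)
  have hηmem : η ∈ densityMatrices d' :=
    uniform_sub_smul_mem_densityMatrices hd' hG₀tr hεG
  refine ⟨ω, fun l => ⟨hωmem l, ?_⟩, η, hηmem, ?_⟩
  · have h : ∀ i, K l i i = 0 := fun i => by
      simpa [dephasing] using congrFun (congrFun (hK0 l) i) i
    ext i j
    by_cases hij : i = j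
    · subst hij
      simp [dephasing, hω, h]
    · simp [dephasing, hij]
  -- Chosen so that `I ⊗ τ - Ω` is exactly `ε/(d+1)` times the dual matrix.
  · set τ : Matrix (Fin d) (Fin d) ℂ := (1 / ((d : ℂ) + 1)) •
      ((1 / (d' : ℂ)) • (1 + (1 + (ε : ℂ) * g) • ρ.transpose) + (ε : ℂ) • T) with hτ
    have hsum : (∑ l : Fin d, Matrix.single l l (1 : ℂ)) = 1 := by
      ext i j
      simp [Matrix.sum_apply, Matrix.single_apply, Matrix.one_apply, ite_and]
    have hηG : η = ((1 + (ε : ℂ) * g) / d') • 1 - (ε : ℂ) • G := by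
      rw [hη, hG₀]
      push_cast
      module
    have hdiff : (1 : Matrix (Fin d') (Fin d') ℂ) ⊗ₖ τ - jointState ω η ρ =
        (1 / ((d : ℂ) + 1)) • (ε : ℂ) • dualMatrix T K G ρ := by
      have hωsum : ∑ l, ω l ⊗ₖ Matrix.single l l (1 : ℂ) =
          (1 / (d' : ℂ)) • ((1 : Matrix (Fin d') (Fin d') ℂ) ⊗ₖ (1 : Matrix (Fin d) (Fin d) ℂ))
            - (ε : ℂ) • ∑ l, K l ⊗ₖ Matrix.single l l (1 : ℂ) := by
        rw [← hsum, Finset.smul_sum]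
        ext x y
        simp [hω, Matrix.sum_apply, sub_mul, Finset.sum_sub_distrib, Finset.mul_sum, mul_assoc,
          Matrix.sub_apply]
      have hηρ : η ⊗ₖ ρ.transpose = ((1 + (ε : ℂ) * g) / d') •
          ((1 : Matrix (Fin d') (Fin d') ℂ) ⊗ₖ ρ.transpose) - (ε : ℂ) • G ⊗ₖ ρ.transpose := by
        rw [hηG]
        ext x y
        simp [sub_mul, mul_assoc]
      rw [jointState, hωsum, hηρ, dualMatrix, hτ]
      simp only [Matrix.kronecker_smul, Matrix.kronecker_add]
      module
    have hc : (0 : ℂ) ≤ 1 / ((d : ℂ) + 1) := one_div_succ_nonneg d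
    have hfeas : ((1 : Matrix (Fin d') (Fin d') ℂ) ⊗ₖ τ - jointState ω η ρ).PosSemidef := by
      rw [hdiff]
      exact (hpos.smul (by exact_mod_cast hε.le : (0 : ℂ) ≤ ε)).smul hc
    have hJ := posSemidef_jointState (fun l => (hωmem l).1) hηmem.1 hρ.1
    -- `T` itself need not be positive; positivity of `τ` follows from `I ⊗ τ ≥ Ω ≥ 0`.
    have hτpos : τ.PosSemidef := posSemidef_of_one_kronecker hd' (by
      simpa using hfeas.add hJ)
    have hle : sInf (feasibleTraces (jointState ω η ρ)) ≤ τ.trace.re := by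
      refine csInf_le ⟨0, ?_⟩ ⟨τ, hτpos, hfeas, rfl⟩
      rintro _ ⟨σ, hσ, -, rfl⟩
      exact (Complex.le_def.mp hσ.trace_nonneg).1
    have hτtr : τ.trace.re =
        ((d + (1 + ε * g)) / d' + ε * T.trace.re) / ((d : ℝ) + 1) := by
      have h : τ.trace = ((1 / ((d : ℝ) + 1) : ℝ) : ℂ) *
          ((((d + (1 + ε * g)) / d' : ℝ) : ℂ) + (ε : ℂ) * T.trace) := by
        rw [hτ]
        simp only [Matrix.trace_smul, Matrix.trace_add, Matrix.trace_transpose, hρ.2,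
          Matrix.trace_one, Fintype.card_fin, smul_eq_mul]
        push_cast
        ring
      rw [h, Complex.re_ofReal_mul, Complex.add_re, Complex.ofReal_re, Complex.re_ofReal_mul]
      ring
    have hηtr : (η * ρ').trace.re = (1 + ε * g) / d' - ε * (G * ρ').trace.re := by
      have h : (η * ρ').trace = (((1 + ε * g) / d' : ℝ) : ℂ) - (ε : ℂ) * (G * ρ').trace := by
        rw [hηG]
        simp only [Matrix.sub_mul, Matrix.smul_mul, one_mul, Matrix.trace_sub,
          Matrix.trace_smul, hρ'.2, smul_eq_mul, mul_one]
        push_cast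
        ring
      rw [h, Complex.sub_re, Complex.ofReal_re, Complex.re_ofReal_mul]
    rw [witness_eq_sInf hωmem hηmem hρ, sub_neg]
    refine hle.trans_lt ?_
    rw [hτtr, hηtr]
    -- The uniform parts cancel, leaving `ε (Tr T + Tr[Gρ'])/(d+1)` as upper bound for the witness.
    have h := mul_neg_of_pos_of_neg hε hneg
    refine div_lt_div_of_pos_right ?_ (by positivity)
    rw [add_div]
    linarith

end Witness

end Coherence

/-! ### The characterisation of convertibility -/

theorem mainTheorem6 (d d' : ℕ)
    (ρ : Matrix (Fin d) (Fin d) ℂ) (hρ : ρ ∈ Coherence.densityMatrices d)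
    (ρ' : Matrix (Fin d') (Fin d') ℂ) (hρ' : ρ' ∈ Coherence.densityMatrices d') :
    Coherence.Convertible ρ ρ' ↔
      ∀ ω : Fin d → Matrix (Fin d') (Fin d') ℂ,
        (∀ l, ω l ∈ Coherence.uniformDiagonalStates d') →
        ∀ η ∈ Coherence.densityMatrices d', 0 ≤ Coherence.witness ω η ρ ρ' := by
  open Coherence in
  constructor
  · rintro ⟨Φ, hΦ, rfl⟩ ω hω η hη
    rw [witness_eq_sInf (fun l => (hω l).1) hη hρ, sub_nonneg]
    exact le_csInf (feasibleTraces_nonempty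
      (posSemidef_jointState (fun l => (hω l).1.1) hη.1 hρ.1).1)
      fun t ht => le_of_mem_feasibleTraces (fun l => (hω l).2) η ρ hΦ ht
  · intro h
    by_contra hconv
    -- A positive semidefinite preimage would be the Choi matrix of a converting operation.
    have hmem : ((1, 0, ρ') : Matrix (Fin d) (Fin d) ℂ × (Fin d → Matrix (Fin d') (Fin d') ℂ) ×
        Matrix (Fin d') (Fin d') ℂ) ∉ constraintMap ρ '' {J | J.PosSemidef} := by
      rintro ⟨J, hJ, hJeq⟩
      obtain ⟨h1, h2⟩ := Prod.ext_iff.mp hJeq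
      obtain ⟨h2, h3⟩ := Prod.ext_iff.mp h2
      refine hconv ⟨mapOfChoi J, (isChannel_mapOfChoi hJ h1).isMaximallyIncoherent fun l => ?_,
        h3⟩
      rw [sub_eq_zero.mp (congrFun h2 l)]
      exact Matrix.isDiag_diagonal _
    obtain ⟨T, K, G, hK, hK0, hG, hpos, hneg⟩ :=
      exists_dualMatrix_of_not_mem hρ.1.1 hρ'.1.1 hmem
    obtain ⟨ω, hω, η, hη, hlt⟩ := exists_witness_neg (pos_of_mem_densityMatrices hρ') hρ hρ'
      hK hK0 hG hpos hneg
    exact (h ω hω η hη).not_gt hlt
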